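/- For $n \ge 1$ let $\mathcal{B}_n$ be the set of $n\times n$ upper-triangular matrices $U$ over the two-element field $\mathbb{F}_2$ with $U^2 = 0$. The two series below converge absolutely; put $$\alpha = \frac{2^{3/2}}{\sqrt{\pi}} \sum_{j \in \mathbb{Z}} (6j+1)\,2^{-3j^2-j}, \qquad \beta' = \frac{2^{5/4}}{\sqrt{\pi}} \sum_{j \in \mathbb{Z}} (6j+2)\,2^{-3j^2-2j}.$$ Then there is a sequence $(\varepsilon_n)_{n \ge 1}$ of real numbers with $\varepsilon_n \to 0$ as $n \to \infty$ such that for every $n \geq 1$ $$|\mathcal{B}_n| = (1+\varepsilon_n)\, \frac{2^{n^2/4+n}}{n^{3/2}} \cdot \begin{cases} \alpha & \text{if } n \text{ is even},\\ \beta' & \text{if } n \text{ is odd}. \end{cases}$$ -/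

import Mathlib

/-- `𝓑ₙ`: the `n × n` upper-triangular matrices over `𝔽₂` (all ranks together) with square zero.
`Matrix.BlockTriangular U id` says `U i j = 0` whenever `j < i`; the diagonal is unrestricted. -/
def upperTriangularRootsOfZero (n : ℕ) : Set (Matrix (Fin n) (Fin n) (ZMod 2)) :=
  {U | U.BlockTriangular id ∧ U ^ 2 = 0}

/-- `α = (2^{3/2} / √π) ∑_{j ∈ ℤ} (6j+1) 2^{-3j²-j}`. -/
noncomputable def alphaConst : ℝ :=
  (2 : ℝ) ^ (3 / 2 : ℝ) / Real.sqrt Real.pi *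
    ∑' j : ℤ, (6 * (j : ℝ) + 1) * (2 : ℝ) ^ (-3 * j ^ 2 - j)

/-- `β' = (2^{5/4} / √π) ∑_{j ∈ ℤ} (6j+2) 2^{-3j²-2j}`. -/
noncomputable def betaConst' : ℝ :=
  (2 : ℝ) ^ (5 / 4 : ℝ) / Real.sqrt Real.pi *
    ∑' j : ℤ, (6 * (j : ℝ) + 2) * (2 : ℝ) ^ (-3 * j ^ 2 - 2 * j)

/-! Deleting the last row and column of a triangular root of zero leaves a smaller one `A`, and a
column can be restored exactly when it lies in `ker A`. Since `range A ⊆ ker A`, an `A` of size n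
and rank r has 2^r extensions of rank r and 2^(n-r) - 2^r of rank r+1. In the height k = n - 2r,
with a Gaussian factor removed, this reads |𝓑ₙ| = 2^(n²/4) (Tⁿg)(0), where (Tf)(k) = f(k+1) + (1 -
2^(-k)) f(k-1) and g(k) = 2^(-k²/4) (`ncard_eq_walkSum`).

The functions c_m = U_m(T/2) g, with U_m the Chebyshev polynomials of the second kind, have a closed
form through Schur's q-Fibonacci polynomials at q = 2 (`chebyshevWeight_step`), and Tⁿg = ∑ C(n,i)
c_{n-2i} (`walkSum_eq_sum`). At k = 0 a pentagonal-number evaluation makes each c_m zero or a signed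
power of 2 (`chebyshevWeight_zero_right`). A reflection of the binomial sum then gives an exact
formula: theta terms weighted by C(n+1, ·) (`hasSum_ncard_third`). Stirling and dominated
convergence yield the limits; positivity of the theta sums permits a relative error. -/

/-! ### Building square-zero triangular matrices column by column -/

theorem mem_upperTriangularRootsOfZero {n : ℕ} {U : Matrix (Fin n) (Fin n) (ZMod 2)} :
    U ∈ upperTriangularRootsOfZero n ↔ U.BlockTriangular id ∧ U * U = 0 := by
  simp [upperTriangularRootsOfZero, sq]

/-- The set `𝓑ₙ` as a finset. -/
noncomputable def triangularRoots (n : ℕ) : Finset (Matrix (Fin n) (Fin n) (ZMod 2)) :=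
  (Set.toFinite (upperTriangularRootsOfZero n)).toFinset

theorem mem_triangularRoots {n : ℕ} {U : Matrix (Fin n) (Fin n) (ZMod 2)} :
    U ∈ triangularRoots n ↔ U.BlockTriangular id ∧ U * U = 0 := by
  simp [triangularRoots, mem_upperTriangularRootsOfZero]

/-- The kernel of a matrix as a finset of vectors. -/
noncomputable def kernelVectors {n : ℕ} (A : Matrix (Fin n) (Fin n) (ZMod 2)) :
    Finset (Fin n → ZMod 2) :=
  (Set.toFinite {v | A.mulVec v = 0}).toFinset

theorem mem_kernelVectors {n : ℕ} {A : Matrix (Fin n) (Fin n) (ZMod 2)} {v : Fin n → ZMod 2} :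
    v ∈ kernelVectors A ↔ A.mulVec v = 0 := by
  simp [kernelVectors]

/-- The matrix `A` with a last column `v` and a zero last row appended. -/
def appendColumn {n : ℕ} (A : Matrix (Fin n) (Fin n) (ZMod 2)) (v : Fin n → ZMod 2) :
    Matrix (Fin (n + 1)) (Fin (n + 1)) (ZMod 2) :=
  Matrix.of fun i j => Fin.lastCases (motive := fun _ => ZMod 2) 0
    (fun i' => Fin.lastCases (motive := fun _ => ZMod 2) (v i') (fun j' => A i' j') j) i

section
variable {n : ℕ} (A : Matrix (Fin n) (Fin n) (ZMod 2)) (v : Fin n → ZMod 2)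

@[simp] theorem appendColumn_castSucc_castSucc (i j : Fin n) :
    appendColumn A v i.castSucc j.castSucc = A i j := by simp [appendColumn]

@[simp] theorem appendColumn_castSucc_last (i : Fin n) :
    appendColumn A v i.castSucc (Fin.last n) = v i := by simp [appendColumn]

@[simp] theorem appendColumn_last (j : Fin (n + 1)) :
    appendColumn A v (Fin.last n) j = 0 := by simp [appendColumn]

end

theorem appendColumn_mem {n : ℕ} {A : Matrix (Fin n) (Fin n) (ZMod 2)} {v : Fin n → ZMod 2}
    (hA : A ∈ triangularRoots n) (hv : v ∈ kernelVectors A) :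
    appendColumn A v ∈ triangularRoots (n + 1) := by
  rw [mem_triangularRoots] at hA ⊢
  rw [mem_kernelVectors] at hv
  refine ⟨fun i j hij => ?_, ?_⟩
  · induction i using Fin.lastCases with
    | last => simp
    | cast i =>
      induction j using Fin.lastCases with
      | last => exact absurd hij (not_lt.2 (Fin.le_last _))
      | cast j => simpa using hA.1 (show id j < id i by simpa using hij)
  · ext i j
    rw [Matrix.mul_apply, Fin.sum_univ_castSucc]
    induction i using Fin.lastCases with
    | last => simp
    | cast i =>
      induction j using Fin.lastCases with
      | last =>
        have := congrFun hv i
        simpa [Matrix.mulVec, dotProduct] using this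
      | cast j =>
        have := congrFun (congrFun hA.2 i) j
        simpa [Matrix.mul_apply] using this

/-- The leading principal block of a square matrix. -/
def leadingBlock {n : ℕ} (U : Matrix (Fin (n + 1)) (Fin (n + 1)) (ZMod 2)) :
    Matrix (Fin n) (Fin n) (ZMod 2) :=
  U.submatrix Fin.castSucc Fin.castSucc

/-- The last column of a square matrix without its last entry. -/
def lastColumn {n : ℕ} (U : Matrix (Fin (n + 1)) (Fin (n + 1)) (ZMod 2)) : Fin n → ZMod 2 :=
  fun i => U i.castSucc (Fin.last n)

/-- Triangularity kills all but the diagonal entry, whose square is an entry of `U * U = 0`. -/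
theorem last_row_eq_zero {n : ℕ} {U : Matrix (Fin (n + 1)) (Fin (n + 1)) (ZMod 2)}
    (hU : U ∈ triangularRoots (n + 1)) (j : Fin (n + 1)) : U (Fin.last n) j = 0 := by
  rw [mem_triangularRoots] at hU
  have h0 : ∀ j : Fin n, U (Fin.last n) j.castSucc = 0 := fun j =>
    hU.1 (show id j.castSucc < id (Fin.last n) from Fin.castSucc_lt_last j)
  induction j using Fin.lastCases with
  | last =>
    have := congrFun (congrFun hU.2 (Fin.last n)) (Fin.last n)
    rw [Matrix.mul_apply, Fin.sum_univ_castSucc] at this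
    simpa [h0] using this
  | cast j => exact h0 j

theorem appendColumn_leadingBlock {n : ℕ} {U : Matrix (Fin (n + 1)) (Fin (n + 1)) (ZMod 2)}
    (hU : U ∈ triangularRoots (n + 1)) : appendColumn (leadingBlock U) (lastColumn U) = U := by
  ext i j
  induction i using Fin.lastCases with
  | last => simp [last_row_eq_zero hU]
  | cast i =>
    induction j using Fin.lastCases with
    | last => simp [lastColumn]
    | cast j => simp [leadingBlock]

theorem leadingBlock_mem {n : ℕ} {U : Matrix (Fin (n + 1)) (Fin (n + 1)) (ZMod 2)}
    (hU : U ∈ triangularRoots (n + 1)) :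
    leadingBlock U ∈ triangularRoots n ∧ lastColumn U ∈ kernelVectors (leadingBlock U) := by
  have hl := last_row_eq_zero hU
  rw [mem_triangularRoots] at hU
  rw [mem_triangularRoots, mem_kernelVectors]
  refine ⟨⟨fun i j hij => hU.1 (show id j.castSucc < id i.castSucc by simpa using hij), ?_⟩, ?_⟩
  · ext i j
    have := congrFun (congrFun hU.2 i.castSucc) j.castSucc
    rw [Matrix.mul_apply, Fin.sum_univ_castSucc] at this
    simpa [leadingBlock, Matrix.mul_apply, hl] using this
  · ext i
    have := congrFun (congrFun hU.2 i.castSucc) (Fin.last n)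
    rw [Matrix.mul_apply, Fin.sum_univ_castSucc] at this
    simpa [leadingBlock, lastColumn, Matrix.mulVec, dotProduct, hl] using this

theorem sum_triangularRoots_succ (n : ℕ) (g : Matrix (Fin (n + 1)) (Fin (n + 1)) (ZMod 2) → ℝ) :
    ∑ U ∈ triangularRoots (n + 1), g U =
      ∑ A ∈ triangularRoots n, ∑ v ∈ kernelVectors A, g (appendColumn A v) := by
  rw [Finset.sum_sigma']
  refine (Finset.sum_bij' (fun p _ => appendColumn p.1 p.2)
    (fun U _ => ⟨leadingBlock U, lastColumn U⟩) ?_ ?_ ?_ ?_ ?_).symm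
  · rintro ⟨A, v⟩ h
    rw [Finset.mem_sigma] at h
    exact appendColumn_mem h.1 h.2
  · intro U hU
    rw [Finset.mem_sigma]
    exact leadingBlock_mem hU
  · rintro ⟨A, v⟩ h
    have h1 : leadingBlock (appendColumn A v) = A := by ext i j; simp [leadingBlock]
    have h2 : lastColumn (appendColumn A v) = v := by ext i; simp [lastColumn]
    simp only [h1, h2]
  · intro U hU
    exact appendColumn_leadingBlock hU
  · intros; rfl

/-! ### Ranks of the extensions -/

/-- Extension of a vector by a zero last coordinate. -/
def extendByZero (n : ℕ) : (Fin n → ZMod 2) →ₗ[ZMod 2] (Fin (n + 1) → ZMod 2) where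
  toFun x := fun i => Fin.lastCases (motive := fun _ => ZMod 2) 0 x i
  map_add' x y := by
    ext i; induction i using Fin.lastCases <;> simp
  map_smul' c x := by
    ext i; induction i using Fin.lastCases <;> simp

theorem extendByZero_injective (n : ℕ) : Function.Injective (extendByZero n) := by
  intro x y h
  ext i
  simpa [extendByZero] using congrFun h i.castSucc

theorem range_appendColumn {n : ℕ} (A : Matrix (Fin n) (Fin n) (ZMod 2)) (v : Fin n → ZMod 2) :
    LinearMap.range (appendColumn A v).mulVecLin =
      (LinearMap.range A.mulVecLin ⊔ Submodule.span (ZMod 2) {v}).map (extendByZero n) := by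
  have key : ∀ (x : Fin n → ZMod 2) (c : ZMod 2) (y : Fin (n + 1) → ZMod 2),
      (∀ i : Fin n, y i.castSucc = x i) → y (Fin.last n) = c →
      (appendColumn A v).mulVec y = extendByZero n (A.mulVec x + c • v) := by
    intro x c y hx hc
    ext i
    rw [Matrix.mulVec, dotProduct, Fin.sum_univ_castSucc]
    induction i using Fin.lastCases with
    | last => simp [extendByZero]
    | cast i => simp [extendByZero, hx, hc, Matrix.mulVec, dotProduct, mul_comm]
  ext z
  simp only [LinearMap.mem_range, Submodule.mem_map, Submodule.mem_sup,
    Submodule.mem_span_singleton, Matrix.mulVecLin_apply]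
  constructor
  · rintro ⟨y, rfl⟩
    exact ⟨_, ⟨_, ⟨_, rfl⟩, _, ⟨y (Fin.last n), rfl⟩, rfl⟩,
      (key (fun i => y i.castSucc) _ y (fun _ => rfl) rfl).symm⟩
  · rintro ⟨_, ⟨_, ⟨x, rfl⟩, _, ⟨c, rfl⟩, rfl⟩, rfl⟩
    exact ⟨Fin.snoc (α := fun _ => ZMod 2) x c, key x c _ (by simp) (by simp)⟩

theorem rank_appendColumn {n : ℕ} (A : Matrix (Fin n) (Fin n) (ZMod 2)) (v : Fin n → ZMod 2) :
    (appendColumn A v).rank =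
      Module.finrank (ZMod 2) ↥(LinearMap.range A.mulVecLin ⊔ Submodule.span (ZMod 2) {v}) := by
  rw [Matrix.rank, range_appendColumn]
  exact (Submodule.equivMapOfInjective _ (extendByZero_injective n) _).finrank_eq.symm

theorem rank_appendColumn_of_mem {n : ℕ} {A : Matrix (Fin n) (Fin n) (ZMod 2)}
    {v : Fin n → ZMod 2} (hv : v ∈ LinearMap.range A.mulVecLin) :
    (appendColumn A v).rank = A.rank := by
  rw [rank_appendColumn, sup_eq_left.2, Matrix.rank]
  rwa [Submodule.span_singleton_le_iff_mem]

theorem rank_appendColumn_of_notMem {n : ℕ} {A : Matrix (Fin n) (Fin n) (ZMod 2)}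
    {v : Fin n → ZMod 2} (hv : v ∉ LinearMap.range A.mulVecLin) :
    (appendColumn A v).rank = A.rank + 1 := by
  rw [rank_appendColumn, Matrix.rank, Submodule.finrank_sup_span_singleton hv]

theorem card_submodule {n : ℕ} (p : Submodule (ZMod 2) (Fin n → ZMod 2)) :
    Nat.card p = 2 ^ Module.finrank (ZMod 2) p := by
  have := Fintype.ofFinite p
  rw [Nat.card_eq_fintype_card, Module.card_eq_pow_finrank (K := ZMod 2), ZMod.card]

theorem card_kernelVectors {n : ℕ} (A : Matrix (Fin n) (Fin n) (ZMod 2)) :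
    ((kernelVectors A).card : ℝ) = 2 ^ ((n : ℝ) - A.rank) := by
  have h1 : (kernelVectors A).card = Nat.card (LinearMap.ker A.mulVecLin) := by
    rw [kernelVectors, ← Nat.card_eq_card_finite_toFinset]
    rfl
  have h2 := A.mulVecLin.finrank_range_add_finrank_ker
  rw [Module.finrank_fin_fun] at h2
  rw [h1, card_submodule]
  push_cast
  rw [← Real.rpow_natCast]
  congr 1
  rw [eq_sub_iff_add_eq, add_comm, Matrix.rank]
  exact_mod_cast h2

/-- As `A * A = 0`, the range lies in the kernel: its 2^r vectors keep the rank, the other kernel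
vectors raise it by one. -/
theorem sum_kernelVectors {n : ℕ} {A : Matrix (Fin n) (Fin n) (ZMod 2)} (hA : A * A = 0)
    (φ : ℕ → ℝ) :
    ∑ v ∈ kernelVectors A, φ (appendColumn A v).rank =
      2 ^ (A.rank : ℝ) * φ A.rank +
        ((2 : ℝ) ^ ((n : ℝ) - A.rank) - 2 ^ (A.rank : ℝ)) * φ (A.rank + 1) := by
  classical
  have hc : (({v ∈ kernelVectors A | v ∈ LinearMap.range A.mulVecLin}.card : ℕ) : ℝ) =
      2 ^ (A.rank : ℝ) := by
    have : {v ∈ kernelVectors A | v ∈ LinearMap.range A.mulVecLin} =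
        (Set.toFinite (LinearMap.range A.mulVecLin : Set (Fin n → ZMod 2))).toFinset := by
      ext v
      simp only [Finset.mem_filter, mem_kernelVectors, Set.Finite.mem_toFinset, SetLike.mem_coe,
        and_iff_right_iff_imp]
      rintro ⟨x, rfl⟩
      rw [Matrix.mulVecLin_apply, Matrix.mulVec_mulVec, hA, Matrix.zero_mulVec]
    rw [this, ← Nat.card_eq_card_finite_toFinset]
    have := card_submodule (LinearMap.range A.mulVecLin)
    rw [Real.rpow_natCast, Matrix.rank]
    exact_mod_cast this
  have hk := card_kernelVectors A
  rw [← Finset.card_filter_add_card_filter_not (fun v => v ∈ LinearMap.range A.mulVecLin),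
    Nat.cast_add, hc] at hk
  rw [← Finset.sum_filter_add_sum_filter_not _ (fun v => v ∈ LinearMap.range A.mulVecLin),
    Finset.sum_congr rfl fun v hv =>
      congrArg φ (rank_appendColumn_of_mem (Finset.mem_filter.1 hv).2),
    Finset.sum_congr (s₁ := Finset.filter (fun v => v ∉ _) _) rfl fun v hv =>
      congrArg φ (rank_appendColumn_of_notMem (Finset.mem_filter.1 hv).2),
    Finset.sum_const, Finset.sum_const, nsmul_eq_mul, nsmul_eq_mul, hc, ← hk, add_sub_cancel_left]

theorem sum_rank_triangularRoots_succ (n : ℕ) (φ : ℕ → ℝ) :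
    ∑ U ∈ triangularRoots (n + 1), φ U.rank =
      ∑ A ∈ triangularRoots n, (2 ^ (A.rank : ℝ) * φ A.rank +
        ((2 : ℝ) ^ ((n : ℝ) - A.rank) - 2 ^ (A.rank : ℝ)) * φ (A.rank + 1)) := by
  rw [sum_triangularRoots_succ]
  exact Finset.sum_congr rfl fun A hA => sum_kernelVectors (mem_triangularRoots.1 hA).2 φ

/-! ### Reduction to a weighted walk -/

/-- The weighted number of `s`-step walks in the height `k` variable. -/
noncomputable def walkSum : ℕ → ℝ → ℝ
  | 0, k => 2 ^ (-k ^ 2 / 4)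
  | s + 1, k => walkSum s (k + 1) + (1 - 2 ^ (-k)) * walkSum s (k - 1)

/-- The exponent is chosen so that one step absorbs 2^r when the rank stays and 2^(n-r) when it
grows; the remaining weights 1 and 1 - 2^(-k) depend on k = n - 2r alone. -/
theorem card_triangularRoots_add (s n : ℕ) :
    ((triangularRoots (n + s)).card : ℝ) = ∑ A ∈ triangularRoots n,
      (2 : ℝ) ^ ((s : ℝ) * A.rank + ((s : ℝ) + (n - 2 * A.rank)) ^ 2 / 4) *
        walkSum s (n - 2 * A.rank) := by
  induction s generalizing n with
  | zero =>
    rw [Finset.card_eq_sum_ones, Nat.cast_sum]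
    refine Finset.sum_congr rfl fun A _ => ?_
    rw [walkSum, ← Real.rpow_add two_pos, Nat.cast_one, eq_comm]
    convert Real.rpow_zero (2 : ℝ) using 2
    push_cast
    ring
  | succ s ih =>
    rw [show n + (s + 1) = (n + 1) + s by ring, ih, sum_rank_triangularRoots_succ n (fun r =>
      (2 : ℝ) ^ ((s : ℝ) * r + ((s : ℝ) + ((n + 1 : ℕ) - 2 * r)) ^ 2 / 4) *
        walkSum s ((n + 1 : ℕ) - 2 * r))]
    refine Finset.sum_congr rfl fun A _ => ?_
    generalize A.rank = r
    push_cast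
    have e1 : (n : ℝ) + 1 - 2 * (r + 1) = n - 2 * r - 1 := by ring
    have e2 : (n : ℝ) + 1 - 2 * r = n - 2 * r + 1 := by ring
    have e3 : (2 : ℝ) ^ (((s : ℝ) + 1) * r + ((s : ℝ) + 1 + (n - 2 * r)) ^ 2 / 4) =
        2 ^ (r : ℝ) * 2 ^ ((s : ℝ) * r + ((s : ℝ) + (n - 2 * r + 1)) ^ 2 / 4) := by
      rw [← Real.rpow_add two_pos]
      congr 1
      ring
    have e4 : (2 : ℝ) ^ (((s : ℝ) + 1) * r + ((s : ℝ) + 1 + (n - 2 * r)) ^ 2 / 4) =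
        2 ^ ((n : ℝ) - r) * 2 ^ ((s : ℝ) * (r + 1) + ((s : ℝ) + (n - 2 * r - 1)) ^ 2 / 4) := by
      rw [← Real.rpow_add two_pos]
      congr 1
      ring
    have e5 : (2 : ℝ) ^ (r : ℝ) = 2 ^ ((n : ℝ) - r) * 2 ^ (-((n : ℝ) - 2 * r)) := by
      rw [← Real.rpow_add two_pos]
      congr 1
      ring
    rw [walkSum, e1, e2]
    linear_combination -walkSum s (n - 2 * r + 1) * e3 -
      (1 - 2 ^ (-((n : ℝ) - 2 * r))) * walkSum s (n - 2 * r - 1) * e4 -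
      2 ^ ((s : ℝ) * (r + 1) + ((s : ℝ) + (n - 2 * r - 1)) ^ 2 / 4) *
        walkSum s (n - 2 * r - 1) * e5

theorem ncard_eq_walkSum (n : ℕ) :
    ((upperTriangularRootsOfZero n).ncard : ℝ) = 2 ^ ((n : ℝ) ^ 2 / 4) * walkSum n 0 := by
  have h0 : triangularRoots 0 = {0} := by
    ext U
    simp [mem_triangularRoots, Subsingleton.elim U 0, Matrix.BlockTriangular]
  have h := card_triangularRoots_add n 0
  rw [h0, Finset.sum_singleton, zero_add] at h
  rw [Set.ncard_eq_toFinset_card _ (Set.toFinite _)]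
  simpa [triangularRoots] using h

/-! ### Schur's Fibonacci polynomials -/

/-- The Carlitz–Schur Fibonacci polynomials `∑ⱼ (-1)ʲ 2^{j(j-1)/2} [m-j choose j] yʲ`. -/
noncomputable def schurFib : ℕ → ℝ → ℝ
  | 0, _ => 1
  | 1, _ => 1
  | m + 2, y => schurFib (m + 1) (2 * y) - y * schurFib m (2 * y)

theorem schurFib_add_two (m : ℕ) (y : ℝ) :
    schurFib (m + 2) y = schurFib (m + 1) (2 * y) - y * schurFib m (2 * y) := by
  rw [schurFib]

theorem schurFib_add_two' (m : ℕ) (y : ℝ) :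
    schurFib (m + 2) y = schurFib (m + 1) y - y * 2 ^ m * schurFib m (y / 2) := by
  induction m using Nat.twoStepInduction generalizing y with
  | zero => simp [schurFib]
  | one => simp [schurFib]; ring
  | more m h0 h1 =>
    have a0 := schurFib_add_two m (y / 2)
    have a1 := schurFib_add_two (m + 1) y
    have a2 := schurFib_add_two (m + 2) y
    have b0 := h0 (2 * y)
    have b1 := h1 (2 * y)
    rw [mul_div_cancel₀ _ (two_ne_zero)] at a0
    rw [mul_div_cancel_left₀ _ (two_ne_zero)] at b0 b1
    linear_combination a2 + b1 - y * b0 - a1 + y * 2 ^ (m + 2) * a0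

/-- The walk shifts k both ways, so y = 2^(-k) is both halved and doubled; each of the two
recurrences handles one direction. -/
theorem schurFib_three_term (m : ℕ) (y : ℝ) :
    schurFib (m + 2) y = y * 2 ^ (m + 1) * (schurFib (m + 1) (y / 2) - schurFib m y) +
      (1 - y) * schurFib (m + 1) (2 * y) := by
  cases m with
  | zero => simp [schurFib]
  | succ m =>
    have h1 := schurFib_add_two m (y / 2)
    have h2 := schurFib_add_two' m (2 * y)
    rw [mul_div_cancel_left₀ _ (two_ne_zero)] at h2
    rw [mul_div_cancel₀ _ (two_ne_zero)] at h1
    rw [schurFib_add_two (m + 1) y, h1, h2]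
    ring

/-! ### Chebyshev expansion of the walk -/

/-- The values at Chebyshev polynomials of the functional sending the Hermite-type basis to
`2 ^ (-k² / 4)`, extended to negative degrees by antisymmetry. -/
noncomputable def chebyshevWeight : ℤ → ℝ → ℝ
  | Int.ofNat m, k => 2 ^ (-(k - m) ^ 2 / 4) * schurFib m (2 ^ (-k))
  | Int.negSucc 0, _ => 0
  | Int.negSucc (m + 1), k => -(2 ^ (-(k - m) ^ 2 / 4) * schurFib m (2 ^ (-k)))

theorem chebyshevWeight_natCast (m : ℕ) (k : ℝ) :
    chebyshevWeight m k = 2 ^ (-(k - m) ^ 2 / 4) * schurFib m (2 ^ (-k)) := rfl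

theorem chebyshevWeight_zero (k : ℝ) : chebyshevWeight 0 k = 2 ^ (-k ^ 2 / 4) := by
  have := chebyshevWeight_natCast 0 k
  simpa [schurFib] using this

theorem chebyshevWeight_one (k : ℝ) : chebyshevWeight 1 k = 2 ^ (-(k - 1) ^ 2 / 4) := by
  have := chebyshevWeight_natCast 1 k
  simpa [schurFib] using this

theorem chebyshevWeight_neg_one (k : ℝ) : chebyshevWeight (-1) k = 0 := rfl

theorem chebyshevWeight_neg_sub_two (m : ℤ) (k : ℝ) :
    chebyshevWeight (-m - 2) k = -chebyshevWeight m k := by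
  have h : ∀ m : ℕ, chebyshevWeight (-m - 2) k = -chebyshevWeight m k := by
    intro m
    rw [show (-(m : ℤ) - 2) = Int.negSucc (m + 1) by rw [Int.negSucc_eq]; push_cast; ring]
    rfl
  obtain hm | hm | hm : 0 ≤ m ∨ m = -1 ∨ m ≤ -2 := by omega
  · lift m to ℕ using hm
    exact h m
  · subst hm
    simp [chebyshevWeight_neg_one]
  · obtain ⟨l, hl⟩ : ∃ l : ℕ, m = -(l : ℤ) - 2 := ⟨(-m - 2).toNat, by omega⟩
    rw [hl, h l]
    simp

/-- This is the Chebyshev recurrence 2x U_m = U_{m+1} + U_{m-1}, with the walk operator as 2x. Once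
the Gaussians are factored out it is `schurFib_three_term`; antisymmetry about m = -1 covers
negative m. -/
theorem chebyshevWeight_step (m : ℤ) (k : ℝ) :
    chebyshevWeight m (k + 1) + (1 - 2 ^ (-k)) * chebyshevWeight m (k - 1) =
      chebyshevWeight (m + 1) k + chebyshevWeight (m - 1) k := by
  have h : ∀ m : ℕ,
      chebyshevWeight m (k + 1) + (1 - 2 ^ (-k)) * chebyshevWeight m (k - 1) =
        chebyshevWeight (m + 1) k + chebyshevWeight (m - 1) k := by
    intro m
    have e1 : (2 : ℝ) ^ (-(k + 1)) = 2 ^ (-k) / 2 := by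
      rw [neg_add, Real.rpow_add two_pos, Real.rpow_neg_one, div_eq_mul_inv]
    have e2 : (2 : ℝ) ^ (-(k - 1)) = 2 * 2 ^ (-k) := by
      rw [neg_sub, sub_eq_add_neg, Real.rpow_add two_pos, Real.rpow_one]
    cases m with
    | zero =>
      simp only [CharP.cast_eq_zero, zero_add, zero_sub, chebyshevWeight_neg_one,
        chebyshevWeight_zero, chebyshevWeight_one, add_zero]
      rw [sub_mul, one_mul, ← Real.rpow_add two_pos,
        show -k + -(k - 1) ^ 2 / 4 = -(k + 1) ^ 2 / 4 by ring]
      ring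
    | succ m =>
      have c1 : ((m + 1 : ℕ) : ℤ) + 1 = (m + 2 : ℕ) := by push_cast; ring
      have c2 : ((m + 1 : ℕ) : ℤ) - 1 = m := by push_cast; ring
      rw [c1, c2]
      simp only [chebyshevWeight_natCast]
      rw [schurFib_three_term m, e1, e2]
      push_cast
      have p1 : (2 : ℝ) ^ (-(k + 1 - (m + 1)) ^ 2 / 4) =
          2 ^ (-(k - (m + 2)) ^ 2 / 4) * (2 ^ (-k) * 2 ^ (m + 1)) := by
        rw [← Real.rpow_natCast _ (m + 1), ← Real.rpow_add two_pos, ← Real.rpow_add two_pos]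
        congr 1
        push_cast
        ring
      have p2 : (2 : ℝ) ^ (-(k - 1 - (m + 1)) ^ 2 / 4) = 2 ^ (-(k - (m + 2)) ^ 2 / 4) := by
        congr 1
        ring
      have p3 : (2 : ℝ) ^ (-(k - m) ^ 2 / 4) =
          2 ^ (-(k - (m + 2)) ^ 2 / 4) * (2 ^ (-k) * 2 ^ (m + 1)) := by
        rw [← p1]
        congr 1
        ring
      rw [p1, p2, p3]
      ring
  obtain hm | hm | hm : 0 ≤ m ∨ m = -1 ∨ m ≤ -2 := by omega
  · lift m to ℕ using hm
    exact h m
  · subst hm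
    have := chebyshevWeight_neg_sub_two 0 k
    norm_num at this ⊢
    rw [this]
    simp [chebyshevWeight_neg_one]
  · obtain ⟨l, hl⟩ : ∃ l : ℕ, m = -(l : ℤ) - 2 := ⟨(-m - 2).toNat, by omega⟩
    have e1 : -(l : ℤ) - 2 + 1 = -((l : ℤ) - 1) - 2 := by ring
    have e2 : -(l : ℤ) - 2 - 1 = -((l : ℤ) + 1) - 2 := by ring
    rw [hl, e1, e2]
    simp only [chebyshevWeight_neg_sub_two]
    linear_combination -h l

/-- Each step moves the index by ±1, and the antisymmetric extension removes any boundary at -1, so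
the coefficients are plain binomials. -/
theorem walkSum_eq_sum (s : ℕ) (k : ℝ) :
    walkSum s k =
      ∑ i ∈ Finset.range (s + 1), (s.choose i : ℝ) * chebyshevWeight (s - 2 * i) k := by
  induction s generalizing k with
  | zero =>
    simp [walkSum, chebyshevWeight_zero]
  | succ s ih =>
    rw [walkSum, ih, ih, Finset.mul_sum, ← Finset.sum_add_distrib]
    have h1 : ∀ i ∈ Finset.range (s + 1),
        (s.choose i : ℝ) * chebyshevWeight (s - 2 * i) (k + 1) +
          (1 - 2 ^ (-k)) * ((s.choose i : ℝ) * chebyshevWeight (s - 2 * i) (k - 1)) =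
        (s.choose i : ℝ) * chebyshevWeight ((s + 1 : ℕ) - 2 * i) k +
          (s.choose i : ℝ) * chebyshevWeight ((s + 1 : ℕ) - 2 * (i + 1 : ℕ)) k := by
      intro i _
      have := chebyshevWeight_step (s - 2 * i) k
      rw [show (((s + 1 : ℕ) : ℤ) - 2 * i) = s - 2 * i + 1 by push_cast; ring,
        show (((s + 1 : ℕ) : ℤ) - 2 * (i + 1 : ℕ)) = s - 2 * i - 1 by push_cast; ring]
      linear_combination (s.choose i : ℝ) * this
    rw [Finset.sum_congr rfl h1, Finset.sum_add_distrib, Finset.sum_range_succ' _ (s + 1)]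
    simp only [Nat.choose_succ_succ, Nat.cast_add, add_mul, Finset.sum_add_distrib]
    rw [Finset.sum_range_succ (fun i => (s.choose (i + 1) : ℝ) * _) s,
      Finset.sum_range_succ' (fun i => (s.choose i : ℝ) * chebyshevWeight (_ - 2 * (i : ℤ)) k) s]
    simp
    ring

/-! ### Pentagonal evaluation at height zero -/

/-- The odd function of period 6 with values `0, 1, 1, 0, -1, -1`. -/
def hexSign (t : ℤ) : ℝ :=
  (if t % 6 = 1 ∨ t % 6 = 2 then 1 else 0) - (if t % 6 = 4 ∨ t % 6 = 5 then 1 else 0)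

/-- The second recurrence halves y and the first doubles it back, which gives a recurrence at y = 1
alone. -/
theorem schurFib_one_add_four (m : ℕ) :
    schurFib (m + 4) 1 =
      schurFib (m + 3) 1 - 2 ^ (m + 2) * (schurFib (m + 1) 1 - schurFib m 1 / 2) := by
  rw [schurFib_add_two' (m + 2), schurFib_add_two m (1 / 2)]
  norm_num
  ring

/-- The exponents are the pentagonal numbers. The last conjunct is what drives the induction. -/
theorem schurFib_one_three_mul (j : ℕ) :
    schurFib (3 * j) 1 = (-1) ^ j * 2 ^ ((3 * (j : ℝ) ^ 2 - j) / 2) ∧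
    schurFib (3 * j + 1) 1 = (-1) ^ j * 2 ^ ((3 * (j : ℝ) ^ 2 + j) / 2) ∧
    schurFib (3 * j + 2) 1 = 0 ∧
    schurFib (3 * j + 3) 1 = -2 ^ (3 * j + 1) * schurFib (3 * j) 1 := by
  induction j with
  | zero => norm_num [schurFib]
  | succ j ih =>
    obtain ⟨h0, h1, h2, k0⟩ := ih
    have k1 : schurFib (3 * j + 4) 1 = -2 ^ (3 * j + 2) * schurFib (3 * j + 1) 1 := by
      rw [schurFib_one_add_four, k0]
      ring
    have k2 : schurFib (3 * j + 5) 1 = 0 := by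
      rw [schurFib_one_add_four, k1, h2]
      ring
    have k3 : schurFib (3 * j + 6) 1 = -2 ^ (3 * j + 4) * schurFib (3 * j + 3) 1 := by
      rw [schurFib_one_add_four (3 * j + 2), k2, h2]
      ring
    refine ⟨?_, ?_, k2, k3⟩
    · rw [show 3 * (j + 1) = 3 * j + 3 by ring, k0, h0, ← Real.rpow_natCast, pow_succ]
      rw [show ((3 * ((j + 1 : ℕ) : ℝ) ^ 2 - (j + 1 : ℕ)) / 2) =
        ((3 * j + 1 : ℕ) : ℝ) + (3 * (j : ℝ) ^ 2 - j) / 2 by push_cast; ring,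
        Real.rpow_add two_pos]
      ring_nf
    · rw [show 3 * (j + 1) + 1 = 3 * j + 4 by ring, k1, h1, ← Real.rpow_natCast, pow_succ]
      rw [show ((3 * ((j + 1 : ℕ) : ℝ) ^ 2 + (j + 1 : ℕ)) / 2) =
        ((3 * j + 2 : ℕ) : ℝ) + (3 * (j : ℝ) ^ 2 + j) / 2 by push_cast; ring,
        Real.rpow_add two_pos]
      ring_nf

theorem hexSign_neg (t : ℤ) : hexSign (-t) = -hexSign t := by
  unfold hexSign
  have h1 : (-t) % 6 = 1 ∨ (-t) % 6 = 2 ↔ t % 6 = 4 ∨ t % 6 = 5 := by omega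
  have h2 : (-t) % 6 = 4 ∨ (-t) % 6 = 5 ↔ t % 6 = 1 ∨ t % 6 = 2 := by omega
  simp only [h1, h2]
  ring

theorem hexSign_add_three (t : ℤ) : hexSign (t + 3) = -hexSign t := by
  unfold hexSign
  have h1 : (t + 3) % 6 = 1 ∨ (t + 3) % 6 = 2 ↔ t % 6 = 4 ∨ t % 6 = 5 := by omega
  have h2 : (t + 3) % 6 = 4 ∨ (t + 3) % 6 = 5 ↔ t % 6 = 1 ∨ t % 6 = 2 := by omega
  simp only [h1, h2]
  ring

theorem hexSign_three_mul_add (j : ℕ) (r : ℤ) : hexSign (3 * j + r) = (-1) ^ j * hexSign r := by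
  induction j with
  | zero => simp
  | succ j ih =>
    rw [show 3 * ((j + 1 : ℕ) : ℤ) + r = 3 * j + r + 3 by push_cast; ring, hexSign_add_three, ih,
      pow_succ]
    ring

/-- The Gaussian and pentagonal exponents combine into one square in m + 1, so a single formula
serves every residue mod 3 and both signs. -/
theorem chebyshevWeight_zero_right (m : ℤ) :
    chebyshevWeight m 0 = hexSign (m + 1) * 2 ^ ((1 - ((m : ℝ) + 1) ^ 2) / 12) := by
  have h : ∀ m : ℕ,
      chebyshevWeight m 0 = hexSign (m + 1) * 2 ^ ((1 - ((m : ℝ) + 1) ^ 2) / 12) := by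
    intro m
    have e : m = 3 * (m / 3) ∨ m = 3 * (m / 3) + 1 ∨ m = 3 * (m / 3) + 2 := by omega
    obtain ⟨s0, s1, s2, -⟩ := schurFib_one_three_mul (m / 3)
    have g1 : hexSign 1 = 1 := by simp [hexSign]
    have g2 : hexSign 2 = 1 := by simp [hexSign]
    have g3 : hexSign 3 = 0 := by simp [hexSign]
    rw [chebyshevWeight_natCast, neg_zero, Real.rpow_zero]
    generalize m / 3 = j at *
    rcases e with rfl | rfl | rfl
    · rw [s0, show ((3 * j : ℕ) : ℤ) + 1 = 3 * j + 1 by push_cast; ring, hexSign_three_mul_add, g1,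
        mul_left_comm, ← Real.rpow_add two_pos, mul_one]
      congr 2
      push_cast
      ring
    · rw [s1, show ((3 * j + 1 : ℕ) : ℤ) + 1 = 3 * j + 2 by push_cast; ring, hexSign_three_mul_add,
        g2, mul_left_comm, ← Real.rpow_add two_pos, mul_one]
      congr 2
      push_cast
      ring
    · rw [s2, show ((3 * j + 2 : ℕ) : ℤ) + 1 = 3 * j + 3 by push_cast; ring, hexSign_three_mul_add,
        g3]
      simp
  obtain hm | hm | hm : 0 ≤ m ∨ m = -1 ∨ m ≤ -2 := by omega
  · lift m to ℕ using hm
    exact h m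
  · subst hm
    simp [chebyshevWeight_neg_one, hexSign]
  · obtain ⟨l, hl⟩ : ∃ l : ℕ, m = -(l : ℤ) - 2 := ⟨(-m - 2).toNat, by omega⟩
    rw [hl, chebyshevWeight_neg_sub_two, h l, show -(l : ℤ) - 2 + 1 = -(l + 1) by ring,
      hexSign_neg, neg_mul]
    push_cast
    congr 4
    ring

/-! ### Binomial sums over the integers and the exact count -/

/-- Binomial coefficients with integer lower index. -/
noncomputable def intChoose (N : ℕ) (i : ℤ) : ℝ :=
  if 0 ≤ i then (N.choose i.toNat : ℝ) else 0

theorem intChoose_natCast (N i : ℕ) : intChoose N i = N.choose i := by simp [intChoose]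

theorem intChoose_of_neg (N : ℕ) {i : ℤ} (hi : i < 0) : intChoose N i = 0 :=
  if_neg (not_le.2 hi)

theorem intChoose_of_lt (N : ℕ) {i : ℤ} (hi : N < i) : intChoose N i = 0 := by
  lift i to ℕ using by omega
  rw [intChoose_natCast, Nat.choose_eq_zero_of_lt (by exact_mod_cast hi), Nat.cast_zero]

theorem intChoose_nonneg (N : ℕ) (i : ℤ) : 0 ≤ intChoose N i := by
  unfold intChoose
  split_ifs <;> positivity

theorem intChoose_symm (N : ℕ) (i : ℤ) : intChoose N (N - i) = intChoose N i := by
  rcases lt_or_ge i 0 with h | h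
  · rw [intChoose_of_neg N h, intChoose_of_lt N (by omega)]
  · lift i to ℕ using h
    rcases lt_or_ge N i with h | h
    · rw [intChoose_of_neg N (by omega), intChoose_of_lt N (by omega)]
    · rw [← Nat.cast_sub h, intChoose_natCast, intChoose_natCast, Nat.choose_symm h]

theorem intChoose_succ (N : ℕ) (i : ℤ) :
    intChoose (N + 1) i = intChoose N (i - 1) + intChoose N i := by
  rcases lt_or_ge i 0 with h | h
  · simp [intChoose_of_neg _ h, intChoose_of_neg N (show i - 1 < 0 by omega)]
  · lift i to ℕ using h
    cases i with
    | zero => simp [intChoose]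
    | succ i =>
      rw [show ((i + 1 : ℕ) : ℤ) - 1 = i by push_cast; ring, intChoose_natCast, intChoose_natCast,
        intChoose_natCast, Nat.choose_succ_succ', Nat.cast_add]

theorem intChoose_mul_succ (N : ℕ) (i : ℤ) :
    intChoose N (i + 1) * (i + 1) = intChoose N i * (N - i) := by
  rcases lt_or_ge i 0 with h | h
  · rw [intChoose_of_neg N h]
    rcases eq_or_lt_of_le (Int.le_sub_one_of_lt h) with h | h
    · simp [h]
    · rw [intChoose_of_neg N (show i + 1 < 0 by omega)]
      simp
  · lift i to ℕ using h
    rw [show (i : ℤ) + 1 = (i + 1 : ℕ) by push_cast; ring, intChoose_natCast, intChoose_natCast]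
    rcases lt_or_ge N i with h | h
    · simp [Nat.choose_eq_zero_of_lt h, Nat.choose_eq_zero_of_lt (Nat.lt_succ_of_lt h)]
    · have := Nat.choose_succ_right_eq N i
      have h2 : ((N.choose (i + 1) * (i + 1) : ℕ) : ℝ) = ((N.choose i * (N - i) : ℕ) : ℝ) := by
        rw [this]
      push_cast [h] at h2
      simpa using h2

/-- A ballot-number identity; its factor N + 1 - 2i becomes the linear factor of the theta series.
-/
theorem intChoose_sub (N : ℕ) (i : ℤ) :
    (N + 1) * (intChoose N i - intChoose N (i - 1)) = intChoose (N + 1) i * (N + 1 - 2 * i) := by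
  have h := intChoose_mul_succ N (i - 1)
  rw [sub_add_cancel] at h
  push_cast at h
  rw [intChoose_succ]
  linear_combination 2 * h

theorem hasSum_intChoose_mul (N : ℕ) (g : ℤ → ℝ) :
    HasSum (fun i : ℤ => intChoose N i * g i)
      (∑ i ∈ Finset.range (N + 1), (N.choose i : ℝ) * g i) := by
  have h : HasSum (fun i : ℕ => intChoose N i * g i)
      (∑ i ∈ Finset.range (N + 1), intChoose N i * g i) := by
    refine hasSum_sum_of_ne_finset_zero fun i hi => ?_
    rw [intChoose_of_lt N (by simpa using hi), zero_mul]
  simp only [intChoose_natCast] at h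
  rw [← Nat.cast_injective.hasSum_iff (g := ((↑) : ℕ → ℤ)) (α := ℝ)]
  · simpa [Function.comp_def, intChoose_natCast] using h
  · intro i hi
    have : i < 0 := by
      by_contra h0
      exact hi ⟨i.toNat, by simpa using h0⟩
    simp [intChoose_of_neg N this]

theorem hasSum_ncard (N : ℕ) :
    HasSum (fun i : ℤ => intChoose N i *
      (hexSign (N + 1 - 2 * i) * 2 ^ ((1 - ((N : ℝ) + 1 - 2 * i) ^ 2) / 12)))
      (((upperTriangularRootsOfZero N).ncard : ℝ) / 2 ^ ((N : ℝ) ^ 2 / 4)) := by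
  rw [ncard_eq_walkSum, mul_div_cancel_left₀ _ (by positivity), walkSum_eq_sum]
  convert hasSum_intChoose_mul N _ using 1
  refine Finset.sum_congr rfl fun i _ => ?_
  rw [chebyshevWeight_zero_right]
  push_cast
  rw [show (N : ℤ) - 2 * i + 1 = N + 1 - 2 * i by ring,
    show (N : ℝ) - 2 * i + 1 = N + 1 - 2 * i by ring]

/-- The parity of the argument is fixed by e, so its residue mod 6 depends only on i mod 3. The two
indicators are exchanged by i ↦ N + 1 - i. -/
theorem hexSign_eq_indicator (n e : ℕ) (he : e < 2) (i : ℤ) :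
    hexSign ((2 * n + e : ℕ) + 1 - 2 * i) =
      (if (3 : ℤ) ∣ n - i then 1 else 0) -
        (if (3 : ℤ) ∣ n - ((2 * n + e : ℕ) + 1 - i) then 1 else 0) := by
  unfold hexSign
  congr 1 <;> refine if_congr ?_ rfl rfl <;> omega

theorem hasSum_ncard_third (n e : ℕ) (he : e < 2) :
    HasSum (fun j : ℤ => intChoose (2 * n + e + 1) (n - 3 * j) *
      ((6 * j + 1 + e) * 2 ^ ((1 - (6 * (j : ℝ) + 1 + e) ^ 2) / 12)))
      ((((2 * n + e : ℕ) : ℝ) + 1) * (((upperTriangularRootsOfZero (2 * n + e)).ncard : ℝ) /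
        2 ^ (((2 * n + e : ℕ) : ℝ) ^ 2 / 4))) := by
  set N := 2 * n + e with hN
  set v : ℤ → ℝ := fun i => 2 ^ ((1 - ((N : ℝ) + 1 - 2 * i) ^ 2) / 12) with hv
  have hv_symm : ∀ i, v (N + 1 - i) = v i := by
    intro i
    simp only [hv]
    congr 3
    push_cast
    ring
  have h0 := hasSum_ncard N
  set p : ℤ → ℝ := fun i => if (3 : ℤ) ∣ n - i then 1 else 0 with hp
  have h1 : HasSum (fun i : ℤ => intChoose N i * (p i * v i))
      (∑' i, intChoose N i * (p i * v i)) := (hasSum_intChoose_mul N _).summable.hasSum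
  -- The reflection i ↦ N + 1 - i fixes `v` and carries the second indicator to the first, replacing
  -- C(N, i) by C(N, i-1).
  have h2 : HasSum (fun i : ℤ => intChoose N (i - 1) * (p i * v i))
      ((∑' i, intChoose N i * (p i * v i)) -
        ((upperTriangularRootsOfZero N).ncard : ℝ) / 2 ^ ((N : ℝ) ^ 2 / 4)) := by
    have h := h1.sub h0
    rw [← (Equiv.subLeft ((N : ℤ) + 1)).hasSum_iff] at h
    refine h.congr_fun fun i => ?_
    have e1 : intChoose N (N + 1 - i) = intChoose N (i - 1) := by
      rw [← intChoose_symm N (i - 1)]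
      congr 1
      ring
    have e2 := hexSign_eq_indicator n e he (N + 1 - i)
    rw [← hN, sub_sub_cancel] at e2
    have e3 := hv_symm i
    simp only [hv] at e3
    simp only [Function.comp_apply, Equiv.subLeft_apply, hv, hp, e1, e2, e3]
    ring
  have h3 := (h1.sub h2).mul_left ((N : ℝ) + 1)
  rw [sub_sub_cancel] at h3
  have hinj : Function.Injective fun j : ℤ => (n : ℤ) - 3 * j := fun a b h => by
    simp only at h
    omega
  rw [← hinj.hasSum_iff] at h3
  · refine h3.congr_fun fun j => ?_
    have hs := intChoose_sub N (n - 3 * j)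
    have hpj : p (n - 3 * j) = 1 := if_pos ⟨j, by ring⟩
    have hNr : (N : ℝ) = 2 * n + e := by rw [hN]; push_cast; ring
    simp only [Function.comp_apply, hpj, one_mul]
    have hvj : v (n - 3 * j) = 2 ^ ((1 - (6 * (j : ℝ) + 1 + e) ^ 2) / 12) := by
      simp only [hv]
      rw [hNr]
      push_cast
      congr 3
      ring
    push_cast at hs
    rw [hvj]
    rw [hNr] at hs ⊢
    linear_combination (-2 ^ ((1 - (6 * (j : ℝ) + 1 + e) ^ 2) / 12)) * hs
  · intro i hi
    have : p i = 0 := if_neg fun ⟨j, hj⟩ => hi ⟨j, by simp only; omega⟩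
    simp [this]

/-! ### Asymptotics of near-central binomial coefficients -/

open Filter Topology

theorem tendsto_sqrt_mul_centralBinom :
    Tendsto (fun n : ℕ => √(n : ℝ) * n.centralBinom / 4 ^ n) atTop (𝓝 (1 / √Real.pi)) := by
  have h1 := Stirling.tendsto_stirlingSeq_sqrt_pi
  have h2 : Tendsto (fun n : ℕ => 2 * n) atTop atTop :=
    tendsto_id.const_mul_atTop' two_pos
  have hpi : √Real.pi ≠ 0 := by positivity
  -- With s_n the Stirling sequence, s_{2n} / s_n² is exactly √n C(2n,n) / 4ⁿ.
  have h3 := (h1.comp h2).div (h1.pow 2) (by positivity)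
  rw [show √Real.pi / √Real.pi ^ 2 = 1 / √Real.pi by field_simp] at h3
  refine h3.congr' ?_
  filter_upwards [eventually_gt_atTop 0] with n hn
  have hn' : (0 : ℝ) < n := by exact_mod_cast hn
  have hc : (n.centralBinom : ℝ) = (2 * n).factorial / (n.factorial : ℝ) ^ 2 := by
    rw [Nat.centralBinom_eq_two_mul_choose, Nat.cast_choose ℝ (by omega : n ≤ 2 * n),
      show 2 * n - n = n by omega, sq]
  have hs : √(2 * ((2 * n : ℕ) : ℝ)) = 2 * √n := by
    push_cast
    rw [← mul_assoc, Real.sqrt_mul (by norm_num), show (2 : ℝ) * 2 = 2 ^ 2 by norm_num,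
      Real.sqrt_sq two_pos.le]
  have hs2 : √(2 * (n : ℝ)) ^ 2 = 2 * n := Real.sq_sqrt (by positivity)
  have hs3 : (n : ℝ) = √n ^ 2 := (Real.sq_sqrt hn'.le).symm
  have hp : (((2 * n : ℕ) : ℝ) / Real.exp 1) ^ (2 * n) = 4 ^ n * (((n : ℝ) / Real.exp 1) ^ n) ^ 2 := by
    push_cast
    rw [mul_div_assoc, mul_pow, pow_mul, ← pow_mul _ n 2, mul_comm n 2]
    norm_num
  have hf : (n.factorial : ℝ) ≠ 0 := by positivity
  have hE : ((n : ℝ) / Real.exp 1) ^ n ≠ 0 := by positivity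
  have hr : √(n : ℝ) ≠ 0 := by positivity
  simp only [Function.comp_apply, Stirling.stirlingSeq, Pi.div_apply]
  rw [hc, hs, hp]
  generalize ((n : ℝ) / Real.exp 1) ^ n = E at *
  rw [div_pow, mul_pow, hs2]
  rw [show (2 : ℝ) * n = 2 * √n ^ 2 by rw [← hs3]]
  field_simp

theorem tendsto_add_div_add (a b : ℝ) :
    Tendsto (fun n : ℕ => ((n : ℝ) + a) / (n + b)) atTop (𝓝 1) := by
  have := tendsto_add_mul_div_add_mul_atTop_nhds a b (1 : ℝ) (one_ne_zero (α := ℝ))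
  simpa [add_comm] using this

theorem intChoose_ratio_step (c : ℕ) (d : ℤ) :
    ∀ᶠ n : ℕ in atTop, intChoose (2 * n + c) (n + (d + 1)) =
      intChoose (2 * n + c) (n + d) * (((n : ℝ) + (c - d)) / (n + (d + 1))) := by
  filter_upwards [eventually_gt_atTop (d + 1).natAbs] with n hn
  have h := intChoose_mul_succ (2 * n + c) (n + d)
  have h0 : (0 : ℝ) < n + (d + 1) := by
    have : (0 : ℤ) < n + (d + 1) := by omega
    exact_mod_cast this
  rw [← add_assoc, ← mul_div_assoc, eq_div_iff h0.ne']
  push_cast at h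
  linear_combination h

/-- Neighbouring coefficients have ratio tending to 1; induction on d runs in both directions. -/
theorem tendsto_intChoose_div (c : ℕ) (d : ℤ) :
    Tendsto (fun n : ℕ => intChoose (2 * n + c) (n + d) / (2 * n + c).choose n) atTop (𝓝 1) := by
  have hpos : ∀ n : ℕ, ((2 * n + c).choose n : ℝ) ≠ 0 := fun n => by
    have := Nat.choose_pos (show n ≤ 2 * n + c by omega)
    positivity
  induction d using Int.induction_on with
  | zero =>
    refine tendsto_const_nhds.congr fun n => ?_
    rw [add_zero, intChoose_natCast, div_self (hpos n)]
  | succ d ih =>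
    have h := ih.mul (tendsto_add_div_add (c - (d : ℤ)) ((d : ℤ) + 1))
    rw [one_mul] at h
    refine h.congr' ?_
    filter_upwards [intChoose_ratio_step c d] with n hn
    rw [hn]
    ring
  | pred d ih =>
    have hρ := tendsto_add_div_add (c - ((-d - 1 : ℤ) : ℝ)) (((-d - 1 : ℤ) : ℝ) + 1)
    have h := ih.div hρ one_ne_zero
    rw [div_one] at h
    refine h.congr' ?_
    filter_upwards [intChoose_ratio_step c (-d - 1), hρ.eventually_ne one_ne_zero] with n hn hne
    rw [sub_add_cancel] at hn
    simp only [Pi.div_apply]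
    rw [hn, mul_div_right_comm, mul_div_cancel_right₀ _ hne]

theorem tendsto_choose_succ_div (c : ℕ) :
    Tendsto (fun n : ℕ => ((2 * n + (c + 1)).choose n : ℝ) / (2 * n + c).choose n) atTop (𝓝 2) := by
  have h := (tendsto_intChoose_div c (-1)).add (tendsto_intChoose_div c 0)
  rw [one_add_one_eq_two] at h
  refine h.congr fun n => ?_
  rw [← add_div, ← intChoose_natCast (2 * n + (c + 1)), ← add_assoc, intChoose_succ, add_zero]
  rfl

theorem tendsto_choose_div_centralBinom (c : ℕ) :
    Tendsto (fun n : ℕ => ((2 * n + c).choose n : ℝ) / n.centralBinom) atTop (𝓝 (2 ^ c)) := by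
  induction c with
  | zero =>
    refine tendsto_const_nhds.congr fun n => ?_
    have := n.centralBinom_pos
    rw [add_zero, ← Nat.centralBinom_eq_two_mul_choose, div_self (by positivity), pow_zero]
  | succ c ih =>
    rw [pow_succ']
    refine ((tendsto_choose_succ_div c).mul ih).congr fun n => ?_
    have := Nat.choose_pos (show n ≤ 2 * n + c by omega)
    exact div_mul_div_cancel₀ (by positivity)

theorem tendsto_sqrt_mul_choose (c : ℕ) :
    Tendsto (fun n : ℕ => √(n : ℝ) * (2 * n + c).choose n / 4 ^ n) atTop
      (𝓝 (2 ^ c / √Real.pi)) := by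
  have h := (tendsto_choose_div_centralBinom c).mul tendsto_sqrt_mul_centralBinom
  rw [mul_one_div] at h
  refine h.congr fun n => ?_
  have : (n.centralBinom : ℝ) ≠ 0 := by
    have := n.centralBinom_pos
    positivity
  field_simp

theorem intChoose_le_two_mul (n e : ℕ) (he : e < 2) (i : ℤ) :
    intChoose (2 * n + (e + 1)) i ≤ 2 * (2 * n + (e + 1)).choose n := by
  rcases lt_or_ge i 0 with h | h
  · rw [intChoose_of_neg _ h]
    positivity
  · lift i to ℕ using h
    rw [intChoose_natCast]
    have h := Nat.choose_le_middle i (2 * n + (e + 1))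
    suffices (2 * n + (e + 1)).choose ((2 * n + (e + 1)) / 2) ≤ 2 * (2 * n + (e + 1)).choose n by
      exact_mod_cast h.trans this
    interval_cases e
    · rw [show (2 * n + (0 + 1)) / 2 = n by omega]
      omega
    · rw [show (2 * n + (1 + 1)) / 2 = n + 1 by omega]
      have h2 := Nat.choose_succ_right_eq (2 * n + (1 + 1)) n
      rw [show 2 * n + (1 + 1) - n = n + 2 by omega] at h2
      nlinarith

/-! ### Theta series: convergence and positivity -/

/-- The terms of the two theta-type series, `e = 0` and `e = 1`. -/
noncomputable def thetaTerm (e : ℕ) (j : ℤ) : ℝ :=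
  (6 * (j : ℝ) + 1 + e) * (2 : ℝ) ^ (-3 * j ^ 2 - (1 + e) * j)

theorem abs_thetaTerm_le {e : ℕ} (he : e < 2) (j : ℤ) :
    |thetaTerm e j| ≤ 64 * (1 / 8) ^ j.natAbs := by
  obtain ⟨a, ha⟩ : ∃ a : ℕ, a = j.natAbs := ⟨_, rfl⟩
  have haj : (a : ℤ) = |j| := by rw [ha]; exact Int.natCast_natAbs j
  have hsq : j ^ 2 = (a : ℤ) ^ 2 := by rw [haj, sq_abs]
  have hjl : -(a : ℤ) ≤ j := by rw [haj]; exact neg_abs_le j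
  have hju : j ≤ a := by rw [haj]; exact le_abs_self j
  have h1 : |6 * (j : ℝ) + 1 + e| ≤ 8 * 2 ^ a := by
    have h2 : a < 2 ^ a := Nat.lt_two_pow_self
    have h3 : |6 * j + 1 + e| ≤ 8 * 2 ^ a := by
      have : (a : ℤ) < 2 ^ a := by exact_mod_cast h2
      rw [abs_le]
      constructor <;> omega
    exact_mod_cast h3
  -- The exponent is at most -3a² + 2a, and 3(a - 1)² ≥ 0 bounds this by 3 - 4a.
  have h2 : (2 : ℝ) ^ (-3 * j ^ 2 - (1 + e) * j) ≤ 2 ^ (3 - 4 * (a : ℤ)) := by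
    refine zpow_le_zpow_right₀ one_le_two ?_
    rw [hsq]
    interval_cases e
    · push_cast
      nlinarith [sq_nonneg ((a : ℤ) - 1)]
    · push_cast
      nlinarith [sq_nonneg ((a : ℤ) - 1)]
  rw [thetaTerm, abs_mul, abs_of_pos (a := (2 : ℝ) ^ _) (by positivity), ← ha]
  refine (mul_le_mul h1 h2 (by positivity) (by positivity)).trans_eq ?_
  rw [zpow_sub₀ two_ne_zero, zpow_mul, zpow_natCast]
  have h16 : (16 : ℝ) ^ a = 2 ^ a * 8 ^ a := by rw [← mul_pow]; norm_num
  norm_num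
  rw [h16, one_div, inv_pow]
  field_simp
  norm_num

theorem summable_thetaTerm {e : ℕ} (he : e < 2) : Summable (thetaTerm e) := by
  have hg : Summable fun n : ℕ => (64 : ℝ) * (1 / 8) ^ n :=
    (summable_geometric_of_lt_one (by norm_num) (by norm_num)).mul_left _
  refine Summable.of_norm_bounded (g := fun j : ℤ => 64 * (1 / 8 : ℝ) ^ j.natAbs) ?_
    (abs_thetaTerm_le he)
  exact Summable.of_nat_of_neg (by simpa using hg) (by simpa using hg)

theorem thetaTerm_pair {e : ℕ} (he : e < 2) (n : ℕ) :
    thetaTerm e n + thetaTerm e (-(n + 1)) = (2 : ℝ) ^ (-3 * (n + 1 : ℤ) ^ 2 + (1 + e) * (n + 1)) *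
      ((6 * n + 1 + e) * 2 ^ ((4 - 2 * e) * n + 2 - e) - (6 * n + 5 - e)) := by
  have : (2 : ℝ) ^ (-3 * (n : ℤ) ^ 2 - (1 + e) * n) =
      2 ^ (-3 * (n + 1 : ℤ) ^ 2 + (1 + e) * (n + 1)) * 2 ^ ((4 - 2 * e) * n + 2 - e) := by
    rw [← zpow_natCast, ← zpow_add₀ two_ne_zero]
    congr 1
    interval_cases e <;> push_cast [Nat.cast_sub] <;> ring_nf
  rw [thetaTerm, thetaTerm, Int.cast_natCast, this]
  rw [show -3 * (-((n : ℤ) + 1)) ^ 2 - (1 + e) * -(n + 1) =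
    -3 * (n + 1 : ℤ) ^ 2 + (1 + e) * (n + 1) by ring]
  push_cast
  ring

/-- Pairing j = n with j = -(n+1) sets each negative term against a positive one that dominates it
for n ≥ 1. -/
theorem tsum_thetaTerm_pos {e : ℕ} (he : e < 2) : 0 < ∑' j, thetaTerm e j := by
  have hs := (summable_thetaTerm he).hasSum.nat_add_neg_add_one
  have hn : ∀ n ∉ Finset.range 2, 0 ≤ thetaTerm e n + thetaTerm e (-(n + 1)) := by
    intro n hn
    rw [thetaTerm_pair he]
    have hn1 : (1 : ℝ) ≤ n := by
      have : 1 ≤ n := by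
        by_contra
        exact hn (Finset.mem_range.2 (by omega))
      exact_mod_cast this
    have he0 : (0 : ℝ) ≤ e := by positivity
    have h2 : (2 : ℝ) ≤ 2 ^ ((4 - 2 * e) * n + 2 - e) :=
      le_self_pow₀ one_le_two (by omega)
    refine mul_nonneg (by positivity) ?_
    nlinarith [mul_le_mul_of_nonneg_left h2 (show (0 : ℝ) ≤ 6 * n + 1 + e by positivity)]
  refine lt_of_lt_of_le ?_ (sum_le_hasSum (Finset.range 2) hn hs)
  -- The pair n = 0 gives -1/4 for e = 0 and 0 for e = 1, so the pair n = 1 is needed for strict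
  -- positivity.
  rw [Finset.sum_range_succ, Finset.sum_range_one, thetaTerm_pair he, thetaTerm_pair he]
  interval_cases e <;> norm_num [zpow_neg]

/-! ### Limits along each parity and the conclusion -/

/-- The number of triangular roots of zero divided by its asymptotic growth rate. -/
noncomputable def normalizedCount (N : ℕ) : ℝ :=
  ((upperTriangularRootsOfZero N).ncard : ℝ) /
    ((2 : ℝ) ^ ((N : ℝ) ^ 2 / 4 + (N : ℝ)) / (N : ℝ) ^ (3 / 2 : ℝ))

theorem rpow_weight_eq {e : ℕ} (he : e < 2) (j : ℤ) :
    (6 * (j : ℝ) + 1 + e) * (2 : ℝ) ^ ((1 - (6 * (j : ℝ) + 1 + e) ^ 2) / 12) =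
      thetaTerm e j * 2 ^ (-(e : ℝ) / 4) := by
  have he2 : (e : ℝ) ^ 2 = e := by interval_cases e <;> simp
  rw [thetaTerm, ← Real.rpow_intCast, mul_assoc, ← Real.rpow_add two_pos]
  congr 2
  push_cast
  linear_combination -he2 / 12

theorem tendsto_ncard_div_choose {e : ℕ} (he : e < 2) :
    Tendsto (fun n : ℕ => ((((2 * n + e : ℕ) : ℝ) + 1) *
      (((upperTriangularRootsOfZero (2 * n + e)).ncard : ℝ) /
        2 ^ (((2 * n + e : ℕ) : ℝ) ^ 2 / 4))) / (2 * n + (e + 1)).choose n) atTop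
      (𝓝 ((∑' j, thetaTerm e j) * 2 ^ (-(e : ℝ) / 4))) := by
  rw [← tsum_mul_right]
  have h : Tendsto (fun n : ℕ => ∑' j : ℤ,
      intChoose (2 * n + (e + 1)) (n - 3 * j) / (2 * n + (e + 1)).choose n *
        (thetaTerm e j * 2 ^ (-(e : ℝ) / 4))) atTop
      (𝓝 (∑' j, thetaTerm e j * 2 ^ (-(e : ℝ) / 4))) := by
    refine tendsto_tsum_of_dominated_convergence
      (bound := fun j => 2 * |thetaTerm e j * 2 ^ (-(e : ℝ) / 4)|) ?_ ?_ ?_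
    · exact (((summable_thetaTerm he).mul_right _).abs).mul_left 2
    · intro j
      have := (tendsto_intChoose_div (e + 1) (-(3 * j))).mul_const
        (thetaTerm e j * 2 ^ (-(e : ℝ) / 4))
      simpa [sub_eq_add_neg] using this
    · refine Eventually.of_forall fun n j => ?_
      have hp : (0 : ℝ) < (2 * n + (e + 1)).choose n := by
        exact_mod_cast Nat.choose_pos (show n ≤ 2 * n + (e + 1) by omega)
      rw [Real.norm_eq_abs, abs_mul]
      refine mul_le_mul_of_nonneg_right ?_ (abs_nonneg _)
      rw [abs_of_nonneg (div_nonneg (intChoose_nonneg _ _) hp.le), div_le_iff₀ hp]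
      exact intChoose_le_two_mul n e he _
  refine h.congr fun n => ?_
  rw [← (hasSum_ncard_third n e he).tsum_eq, ← tsum_div_const]
  refine tsum_congr fun j => ?_
  rw [rpow_weight_eq he, add_assoc (2 * n)]
  ring

theorem tendsto_natCast_div_two_mul_add (e : ℕ) :
    Tendsto (fun n : ℕ => ((2 * n + e : ℕ) : ℝ) / n) atTop (𝓝 2) := by
  have := tendsto_add_mul_div_add_mul_atTop_nhds (e : ℝ) 0 2 (one_ne_zero (α := ℝ))
  simpa [add_comm] using this

theorem tendsto_normalizedCount {e : ℕ} (he : e < 2) :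
    Tendsto (fun n : ℕ => normalizedCount (2 * n + e)) atTop
      (𝓝 (2 ^ (3 / 2 - (e : ℝ) / 4) / √Real.pi * ∑' j, thetaTerm e j)) := by
  have h1 := tendsto_ncard_div_choose he
  have h2 := tendsto_sqrt_mul_choose (e + 1)
  have h3 := (tendsto_natCast_div_two_mul_add e).sqrt
  have h4 : Tendsto (fun n : ℕ => ((2 * n + e : ℕ) : ℝ) / ((2 * n + e : ℕ) + 1)) atTop (𝓝 1) := by
    have h5 : Tendsto (fun n : ℕ => 2 * n + e) atTop atTop :=
      tendsto_atTop_mono (fun n => by simp only [id]; omega) tendsto_id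
    exact (tendsto_natCast_div_add_atTop (1 : ℝ)).comp h5
  have h := ((h1.mul h2).mul (h3.mul h4)).mul_const ((2 : ℝ) ^ e)⁻¹
  -- For N = 2n + e, √2 is the limit of √(N/n), and the inverse of 2^e corrects 4ⁿ to 2^N.
  have hlim : (∑' j, thetaTerm e j) * 2 ^ (-(e : ℝ) / 4) * (2 ^ (e + 1) / √Real.pi) * (√2 * 1) *
      ((2 : ℝ) ^ e)⁻¹ = 2 ^ (3 / 2 - (e : ℝ) / 4) / √Real.pi * ∑' j, thetaTerm e j := by
    have : (2 : ℝ) ^ (3 / 2 - (e : ℝ) / 4) = 2 * √2 * 2 ^ (-(e : ℝ) / 4) := by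
      rw [Real.sqrt_eq_rpow, show (3 / 2 - (e : ℝ) / 4) = 1 + 1 / 2 + -(e : ℝ) / 4 by ring,
        Real.rpow_add two_pos, Real.rpow_add two_pos, Real.rpow_one]
    rw [this, pow_succ]
    field_simp
  rw [hlim] at h
  refine h.congr' ?_
  filter_upwards [eventually_gt_atTop 0] with n hn
  have hn' : (0 : ℝ) < n := by exact_mod_cast hn
  have hp : (0 : ℝ) < (2 * n + (e + 1)).choose n := by
    exact_mod_cast Nat.choose_pos (show n ≤ 2 * n + (e + 1) by omega)
  have hN : (0 : ℝ) < (2 * n + e : ℕ) := by exact_mod_cast (show 0 < 2 * n + e by omega)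
  have hpow : (2 : ℝ) ^ ((2 * n + e : ℕ) : ℝ) = 4 ^ n * 2 ^ e := by
    rw [Real.rpow_natCast, pow_add, pow_mul]
    norm_num
  rw [normalizedCount, Real.rpow_add two_pos, hpow, Real.sqrt_div hN.le,
    show (3 / 2 : ℝ) = 1 + 1 / 2 by norm_num, Real.rpow_add hN, Real.rpow_one, ← Real.sqrt_eq_rpow]
  have : √(n : ℝ) ≠ 0 := by positivity
  field_simp

theorem tendsto_of_tendsto_two_mul {u : ℕ → ℝ} {a : ℝ}
    (h : ∀ e : ℕ, e < 2 → Tendsto (fun n : ℕ => u (2 * n + e)) atTop (𝓝 a)) : Tendsto u atTop (𝓝 a) := by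
  intro s hs
  obtain ⟨A, hA⟩ := eventually_atTop.1 ((h 0 two_pos) hs)
  obtain ⟨B, hB⟩ := eventually_atTop.1 ((h 1 one_lt_two) hs)
  refine eventually_atTop.2 ⟨2 * (A + B) + 2, fun N hN => ?_⟩
  rcases Nat.even_or_odd' N with ⟨k, rfl | rfl⟩
  · exact hA k (by omega)
  · exact hB k (by omega)

theorem alphaConst_eq : alphaConst = 2 ^ (3 / 2 - ((0 : ℕ) : ℝ) / 4) / √Real.pi *
    ∑' j, thetaTerm 0 j := by
  simp [alphaConst, thetaTerm]

theorem betaConst'_eq : betaConst' = 2 ^ (3 / 2 - ((1 : ℕ) : ℝ) / 4) / √Real.pi *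
    ∑' j, thetaTerm 1 j := by
  have h : ∀ j : ℤ, thetaTerm 1 j = (6 * (j : ℝ) + 2) * (2 : ℝ) ^ (-3 * j ^ 2 - 2 * j) := by
    intro j
    rw [thetaTerm]
    norm_num
    ring_nf
    simp
  rw [betaConst', tsum_congr h]
  norm_num

theorem mainTheorem4 :
    (Summable fun j : ℤ => (6 * (j : ℝ) + 1) * (2 : ℝ) ^ (-3 * j ^ 2 - j)) ∧
    (Summable fun j : ℤ => (6 * (j : ℝ) + 2) * (2 : ℝ) ^ (-3 * j ^ 2 - 2 * j)) ∧
    ∃ ε : ℕ → ℝ, Filter.Tendsto ε Filter.atTop (nhds 0) ∧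
      ∀ n : ℕ, 1 ≤ n →
        ((upperTriangularRootsOfZero n).ncard : ℝ) =
          (1 + ε n) * ((2 : ℝ) ^ ((n : ℝ) ^ 2 / 4 + (n : ℝ)) / (n : ℝ) ^ (3 / 2 : ℝ)) *
            (if Even n then alphaConst else betaConst') := by
  -- The error is relative, so both constants must be nonzero.
  have hpos : ∀ e : ℕ, e < 2 → (0 : ℝ) < 2 ^ (3 / 2 - (e : ℝ) / 4) / √Real.pi * ∑' j, thetaTerm e j :=
    fun e he => mul_pos (by positivity) (tsum_thetaTerm_pos he)
  have hα : alphaConst ≠ 0 := alphaConst_eq ▸ (hpos 0 two_pos).ne'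
  have hβ : betaConst' ≠ 0 := betaConst'_eq ▸ (hpos 1 one_lt_two).ne'
  refine ⟨?_, ?_, fun n => normalizedCount n / (if Even n then alphaConst else betaConst') - 1,
    ?_, ?_⟩
  · convert summable_thetaTerm two_pos using 2 with j
    simp [thetaTerm]
  · convert summable_thetaTerm one_lt_two using 2 with j
    rw [thetaTerm]
    congr 1
    push_cast
    ring
  · refine tendsto_of_tendsto_two_mul fun e he => ?_
    have h := tendsto_normalizedCount he
    interval_cases e
    · rw [← alphaConst_eq] at h
      simpa [hα] using (h.div_const alphaConst).sub_const 1
    · rw [← betaConst'_eq] at h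
      have h2 := (h.div_const betaConst').sub_const 1
      rw [div_self hβ, sub_self] at h2
      refine h2.congr fun n => ?_
      rw [if_neg (by simp)]
  · intro n hn
    have hn' : (0 : ℝ) < n := by exact_mod_cast hn
    have hc : (if Even n then alphaConst else betaConst') ≠ 0 := by split_ifs <;> assumption
    have h3 : (2 : ℝ) ^ ((n : ℝ) ^ 2 / 4 + (n : ℝ)) / (n : ℝ) ^ (3 / 2 : ℝ) ≠ 0 := by positivity
    rw [add_sub_cancel, normalizedCount]
    generalize (if Even n then alphaConst else betaConst') = c at *
    rw [div_mul_eq_mul_div, div_mul_cancel₀ _ h3, div_mul_cancel₀ _ hc]
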